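/- Let $K$ be a field and let $G$ be a finite simple graph (no loops, no multiple edges) with nonempty vertex set $V$ and without isolated vertices. Let $S=K[x_v : v\in V]$, let $\mathfrak m=(x_v : v\in V)$, and let $J(G)=\bigcap_{\{i,j\}\in E(G)}(x_i,x_j)\subseteq S$ be the cover ideal of $G$. For an ideal $I\subseteq S$ let $I^{(k)}=(I^kS_W)\cap S$ denote its $k$-th symbolic power, where $W$ is the complement in $S$ of the union of the associated primes of $I$, and let $R(I)_s=\bigoplus_{k\ge 0}I^{(k)}t^k\subseteq S[t]$ be its symbolic Rees algebra. Let $$\bar A(G)=R(J(G))_s/\mathfrak m R(J(G))_s$$ be the symbolic fiber cone of $J(G)$. A nonempty independent set of vertices $A=\{a_1,\dots,a_r\}\subseteq V$ with $|A|=r$ is called a free parameter set of $G$ if, for a suitable labeling of its elements, there is a set $B=\{b_1,\dots,b_r\}\subseteq V$ of $r$ vertices with $A\cap B=\emptyset$ such that $\{a_i,b_i\}\in E(G)$ for all $1\le i\le r$, and $\{a_i,b_j\}\in E(G)$ implies $i\le j$. The graphical dimension of $G$ is $$\operatorname{gdim}(G)=\max\{|A| : A\subseteq V \text{ is a free parameter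 set of } G\}+1.$$ Then the Krull dimension of $\bar A(G)$ equals the graphical dimension of $G$: $$\dim \bar A(G)=\operatorname{gdim}(G).$$ -/

import Mathlib

namespace SymbolicFiber

section Algebra

variable {R : Type*} [CommRing R]

/-- The multiplicative system `W` of an ideal `I`: the complement in `R` of the union of the
associated primes of `I`, that is, of the associated primes of the module `R ⧸ I`. (For a Noetherian
ring `R`, such as a polynomial ring in finitely many variables over a field, these are the primes
that are annihilators of elements of `R ⧸ I`.) -/
def assPrimesCompl (I : Ideal R) : Submonoid R where
  carrier := {w | ∀ p ∈ associatedPrimes R (R ⧸ I), w ∉ p}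
  one_mem' := fun p hp => (Ideal.ne_top_iff_one p).mp
    (IsAssociatedPrime.isPrime (AssociatedPrimes.mem_iff.mp hp)).ne_top
  mul_mem' := fun ha hb p hp hab =>
    ((IsAssociatedPrime.isPrime (AssociatedPrimes.mem_iff.mp hp)).mem_or_mem hab).elim
      (ha p hp) (hb p hp)

/-- The `k`-th symbolic power `I⁽ᵏ⁾ = (Iᵏ R_W) ∩ R`, where `R_W` is the localization of `R` at the
complement `W` of the union of the associated primes of `I`. -/
def symbolicPower (I : Ideal R) (k : ℕ) : Ideal R :=
  ((I ^ k).map (algebraMap R (Localization (assPrimesCompl I)))).comap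
    (algebraMap R (Localization (assPrimesCompl I)))

theorem symbolicPower_zero (I : Ideal R) : symbolicPower I 0 = ⊤ := by
  simp [symbolicPower, Ideal.one_eq_top, Ideal.map_top]

theorem symbolicPower_mul_mem (I : Ideal R) {j k : ℕ} {a b : R}
    (ha : a ∈ symbolicPower I j) (hb : b ∈ symbolicPower I k) :
    a * b ∈ symbolicPower I (j + k) := by
  rw [symbolicPower, Ideal.mem_comap] at *
  rw [map_mul, pow_add, Ideal.map_mul]
  exact Ideal.mul_mem_mul ha hb

open Polynomial in
/-- The symbolic Rees algebra `⨁ₖ I⁽ᵏ⁾ tᵏ`, as an `R`-subalgebra of the polynomial ring `R[t]`. -/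
def symbolicReesAlgebra (I : Ideal R) : Subalgebra R R[X] where
  carrier := {f | ∀ k, f.coeff k ∈ symbolicPower I k}
  mul_mem' := fun {f g} hf hg k => by
    rw [coeff_mul]
    refine Ideal.sum_mem _ fun e he => ?_
    rw [← Finset.HasAntidiagonal.mem_antidiagonal.mp he]
    exact symbolicPower_mul_mem I (hf e.1) (hg e.2)
  add_mem' := fun {f g} hf hg k => by
    rw [coeff_add]
    exact Ideal.add_mem _ (hf k) (hg k)
  algebraMap_mem' := fun r k => by
    rw [Polynomial.algebraMap_apply, coeff_C]
    split_ifs with h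
    · subst h
      rw [symbolicPower_zero]
      trivial
    · exact Ideal.zero_mem _

end Algebra

section Graph

variable {V : Type*}

/-- The cover ideal `J(G) = ⋂ (xᵢ, xⱼ)` in `K[x_v : v ∈ V]`, the intersection running over the
edges `{i, j}` of `G`. -/
noncomputable def coverIdeal (K : Type*) [Field K] (G : SimpleGraph V) :
    Ideal (MvPolynomial V K) :=
  ⨅ (i : V) (j : V) (_ : G.Adj i j), Ideal.span {MvPolynomial.X i, MvPolynomial.X j}

/-- The irrelevant maximal ideal `𝔪` of `K[x_v : v ∈ V]`, generated by the variables. -/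
noncomputable def irrelevantIdeal (K : Type*) [Field K] (V : Type*) :
    Ideal (MvPolynomial V K) :=
  Ideal.span (Set.range MvPolynomial.X)

/-- The algebra `Ā(G)`: the symbolic fiber cone `R_s / 𝔪 R_s` of the cover ideal of `G`, where
`R_s` is the symbolic Rees algebra of the cover ideal. -/
abbrev symbolicFiberCone (K : Type*) [Field K] (G : SimpleGraph V) : Type _ :=
  symbolicReesAlgebra (coverIdeal K G) ⧸
    (irrelevantIdeal K V).map
      (algebraMap (MvPolynomial V K) (symbolicReesAlgebra (coverIdeal K G)))

/-- A free parameter set of `G`: a nonempty independent set `A = {a₁, …, a_r}` of vertices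
(`r = |A|`) for which, with a suitable labeling, there is a set `B = {b₁, …, b_r}` of vertices
disjoint from `A` such that `aᵢ` is adjacent to `bᵢ`, and `aᵢ` adjacent to `bⱼ` implies `i ≤ j`. -/
def IsFreeParameterSet (G : SimpleGraph V) (A : Finset V) : Prop :=
  A.Nonempty ∧ G.IsIndepSet (A : Set V) ∧
    ∃ a b : Fin A.card → V,
      Function.Injective a ∧ Set.range a = (A : Set V) ∧
      Function.Injective b ∧ Disjoint (A : Set V) (Set.range b) ∧
      (∀ i, G.Adj (a i) (b i)) ∧
      ∀ i j, G.Adj (a i) (b j) → i ≤ j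

open Classical in
/-- The graphical dimension: one more than the maximal cardinality of a free parameter set. -/
noncomputable def gdim [Fintype V] (G : SimpleGraph V) : ℕ :=
  (Finset.univ.filter fun A : Finset V => IsFreeParameterSet G A).sup Finset.card + 1

end Graph

end SymbolicFiber

/-! A monomial lies in the `k`-th symbolic power of the cover ideal exactly when its exponent vector
is a `k`-cover (`mem_symbolicPower_coverIdeal_iff`), so the monomials `x^α t^k` with `α` a `k`-cover
form a `K`-basis of the symbolic Rees algebra. Modulo `𝔪` the basic covers suffice as spanning set:
those in which every vertex lies on a tight edge, one with `α u + α v = k`.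

Upper bound: pick one vertex for each value below `k / 2` of a basic `k`-cover, together with a
tight neighbour of each. This is a free parameter set (`card_small_values_lt_gdim`). Hence, if `gdim
G = r + 1`, a basic cover is encoded by its degree, `r` numbers and one of finitely many labellings,
and the part of degree at most `N` has dimension at most `C (N + 1) ^ (r + 1)`. A chain of primes of
length `n` yields `n` algebraically independent elements
(`exists_algebraicIndependent_of_ltSeries`), which force growth of order `N ^ n`; so `n ≤ r + 1`
(`card_le_of_filtration_le_span`). Finite generation is not needed.

Lower bound: a free parameter set of size `r` carries a basic `(2 r + 2)`-cover `α` with `r`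
distinct values below `r + 1` (`exists_isCover_of_freeParameters`). The covers tight wherever `α` is
tight form a face of the cover monoid. Imposing zeros on more and more parameters, and adding the
zero face, gives `r + 2` nested faces. Killing the monomials outside a face is a ring homomorphism
to a domain, so the kernels form a chain of primes, all containing `𝔪`
(`le_ringKrullDim_symbolicFiberCone_of_faces`). -/

namespace SymbolicFiber

/-! ### Algebraically independent elements from chains of primes -/

section ChainsOfPrimes

open MvPolynomial

theorem aeval_eq_eval₂_finSuccEquiv {K R : Type*} [Field K] [CommRing R] [Algebra K R] {n : ℕ}
    (x : Fin (n + 1) → R) (F : MvPolynomial (Fin (n + 1)) K) :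
    aeval x F = Polynomial.eval₂ (aeval (fun i : Fin n => x i.succ) :
      MvPolynomial (Fin n) K →ₐ[K] R).toRingHom (x 0) (finSuccEquiv K n F) := by
  induction F using MvPolynomial.induction_on with
  | C a => simp [finSuccEquiv_apply]
  | add p q hp hq => simp only [map_add, Polynomial.eval₂_add, hp, hq]
  | mul_X p i hp =>
    simp only [map_mul, Polynomial.eval₂_mul, hp, aeval_X]
    congr 1
    refine Fin.cases ?_ (fun j => ?_) i <;> simp [finSuccEquiv_apply]

/-- Elements separating the successive members of a chain of prime ideals satisfy no polynomial
relation modulo the smallest member of the chain. -/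
theorem eq_zero_of_aeval_mem_of_chain {K R : Type*} [Field K] [CommRing R] [Algebra K R] :
    ∀ (n : ℕ) (p : Fin (n + 1) → Ideal R) (_ : ∀ i, (p i).IsPrime) (x : Fin n → R)
      (_ : ∀ i : Fin n, p i.castSucc ≤ p i.succ) (_ : ∀ i : Fin n, x i ∈ p i.succ)
      (_ : ∀ i : Fin n, x i ∉ p i.castSucc) (F : MvPolynomial (Fin n) K),
      aeval x F ∈ p 0 → F = 0
  | 0, p, hp, x, _, _, _, F, hF => by
    by_contra h
    obtain ⟨a, rfl⟩ := C_surjective (Fin 0) F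
    refine (hp 0).ne_top (Ideal.eq_top_of_isUnit_mem _ hF ?_)
    have ha : a ≠ 0 := by rintro rfl; simp at h
    simpa using (isUnit_iff_ne_zero.mpr ha).map (algebraMap K R)
  | n + 1, p, hp, x, hle, hx, hx', F, hF => by
    by_contra h
    have hg : finSuccEquiv K n F ≠ 0 := by simpa using h
    -- Dividing out the largest power of the variable separating `p 0` from `p 1` leaves a `q` with
    -- nonzero constant term. Its value still lies in `p 0`, and modulo `p 1` only the constant term
    -- survives: a relation for the shorter chain.
    obtain ⟨q, hq, hq0⟩ :=
      (finSuccEquiv K n F).exists_eq_pow_rootMultiplicity_mul_and_not_dvd hg 0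
    rw [aeval_eq_eval₂_finSuccEquiv, hq, Polynomial.eval₂_mul, Polynomial.eval₂_pow] at hF
    simp only [map_zero, sub_zero, Polynomial.eval₂_X] at hF hq0
    have hF' := ((hp 0).mem_or_mem hF).resolve_left fun h => hx' 0 ((hp 0).mem_of_pow_mem _ h)
    have h1 := hle 0 hF'
    rw [← Polynomial.divX_mul_X_add q, Polynomial.eval₂_add, Polynomial.eval₂_mul,
      Polynomial.eval₂_X, Polynomial.eval₂_C] at h1
    have h2 := (Ideal.add_mem_iff_right _ (Ideal.mul_mem_left _ _ (hx 0))).mp h1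
    have h3 := eq_zero_of_aeval_mem_of_chain n (fun i => p i.succ) (fun i => hp _)
      (fun i => x i.succ) (fun i => by simpa using hle i.succ) (fun i => hx i.succ)
      (fun i => by simpa using hx' i.succ) (q.coeff 0) h2
    exact hq0 (Polynomial.X_dvd_iff.mpr h3)

/-- A chain of primes of length `n` in a `K`-algebra yields `n` algebraically independent
elements. -/
theorem exists_algebraicIndependent_of_ltSeries (K : Type*) {R : Type*} [Field K] [CommRing R]
    [Algebra K R] (l : LTSeries (PrimeSpectrum R)) :
    ∃ x : Fin l.length → R, AlgebraicIndependent K x := by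
  have hlt : ∀ i : Fin l.length, (l i.castSucc).asIdeal < (l i.succ).asIdeal := fun i => l.step i
  choose x hx hx' using fun i => SetLike.exists_of_lt (hlt i)
  refine ⟨x, (injective_iff_map_eq_zero _).mpr fun F hF => ?_⟩
  refine eq_zero_of_aeval_mem_of_chain l.length (fun i => (l i).asIdeal)
    (fun i => (l i).isPrime) x (fun i => (hlt i).le) hx hx' F ?_
  rw [hF]
  exact zero_mem _

end ChainsOfPrimes

/-! ### Polynomial growth bounds algebraic independence -/

section Growth

/-- If the `N`-th piece of a filtered algebra is contained in the span of at most `C (N + 1) ^ d`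
elements, then the algebra has no more than `d` algebraically independent elements. -/
theorem card_le_of_filtration_le_span {K R : Type*} [Field K] [CommRing R] [Algebra K R]
    (U : ℕ → Submodule K R) (hmono : Monotone U) (hone : 1 ∈ U 0)
    (hmul : ∀ {m n : ℕ} {a b : R}, a ∈ U m → b ∈ U n → a * b ∈ U (m + n))
    (hex : ∀ a, ∃ n, a ∈ U n) {C d : ℕ}
    (hspan : ∀ N, ∃ s : Finset R, s.card ≤ C * (N + 1) ^ d ∧ U N ≤ Submodule.span K s) {n : ℕ} {x : Fin n → R}
    (hx : AlgebraicIndependent K x) : n ≤ d := by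
  have hfin : ∀ N, FiniteDimensional K (U N) := fun N => by
    obtain ⟨s, -, hs⟩ := hspan N
    exact Submodule.finiteDimensional_of_le hs
  have hC : ∀ N, Module.finrank K (U N) ≤ C * (N + 1) ^ d := fun N => by
    obtain ⟨s, hsc, hs⟩ := hspan N
    exact (Submodule.finrank_mono hs).trans ((finrank_span_finset_le_card s).trans hsc)
  choose deg hdeg using fun i => hex (x i)
  obtain ⟨c, hc⟩ : ∃ c, ∀ i, x i ∈ U c :=
    ⟨Finset.univ.sup deg, fun i => hmono (Finset.le_sup (Finset.mem_univ i)) (hdeg i)⟩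
  have hpow : ∀ (k : ℕ) (i : Fin n), x i ^ k ∈ U (c * k) := by
    intro k i
    induction k with
    | zero => simpa using hone
    | succ k ih => rw [pow_succ, mul_add, mul_one]; exact hmul ih (hc i)
  have hprod : ∀ (e : Fin n → ℕ) (s : Finset (Fin n)),
      ∏ i ∈ s, x i ^ e i ∈ U (∑ i ∈ s, c * e i) := by
    intro e s
    classical
    induction s using Finset.induction_on with
    | empty => simpa using hone
    | insert i s hi ih => rw [Finset.prod_insert hi, Finset.sum_insert hi]; exact hmul (hpow _ _) ih
  have hlin : LinearIndependent K fun e : Fin n →₀ ℕ => ∏ i, x i ^ e i := by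
    have := (MvPolynomial.basisMonomials (Fin n) K).linearIndependent.map'
      (MvPolynomial.aeval x : MvPolynomial (Fin n) K →ₐ[K] R).toLinearMap
      (LinearMap.ker_eq_bot.mpr hx)
    have he : (fun e : Fin n →₀ ℕ => ∏ i, x i ^ e i) =
        (MvPolynomial.aeval x : MvPolynomial (Fin n) K →ₐ[K] R).toLinearMap ∘
          MvPolynomial.basisMonomials (Fin n) K := by
      ext e
      simp [MvPolynomial.aeval_monomial, Finsupp.prod_fintype]
    rw [he]
    exact this
  -- The monomials with all exponents at most `N` are independent and lie in `U (c * n * N)`.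
  have key : ∀ N : ℕ, (N + 1) ^ n ≤ C * (c * n + 1) ^ d * (N + 1) ^ d := by
    intro N
    let v : (Fin n → Fin (N + 1)) → U (c * n * N) := fun e =>
      ⟨∏ i, x i ^ (e i : ℕ), hmono (by
        calc ∑ i, c * (e i : ℕ) ≤ ∑ _i : Fin n, c * N :=
              Finset.sum_le_sum fun i _ => Nat.mul_le_mul_left _ (Nat.lt_succ_iff.mp (e i).2)
          _ = c * n * N := by simp; ring) (hprod (fun i => e i) Finset.univ)⟩
    have hv : LinearIndependent K v := by
      refine LinearIndependent.of_comp (U (c * n * N)).subtype ?_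
      refine hlin.comp (fun e : Fin n → Fin (N + 1) =>
        Finsupp.equivFunOnFinite.symm fun i => (e i : ℕ)) ?_
      intro e e' h
      ext i
      exact DFunLike.congr_fun h i
    have h1 := hv.fintype_card_le_finrank
    simp only [Fintype.card_pi, Fintype.card_fin, Finset.prod_const, Finset.card_univ] at h1
    refine h1.trans ((hC _).trans ?_)
    rw [mul_assoc C, ← mul_pow]
    refine Nat.mul_le_mul_left _ (Nat.pow_le_pow_left ?_ _)
    nlinarith [Nat.zero_le (c * n), Nat.zero_le N]
  by_contra! hlt
  -- Taking `N` equal to the constant `D` itself already contradicts `d < n`.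
  set D := C * (c * n + 1) ^ d
  have h := key D
  have h2 : (D + 1) ^ (d + 1) ≤ (D + 1) ^ n := Nat.pow_le_pow_right (by omega) hlt
  have h3 := h2.trans h
  rw [pow_succ, mul_comm] at h3
  have := Nat.le_of_mul_le_mul_right h3 (by positivity)
  omega

end Growth

/-! ### Projections onto faces of exponent monoids -/

section Faces

open MvPolynomial

/-- The linear projection of a polynomial ring onto the span of the monomials satisfying `Z`. -/
noncomputable def monomialProj (K : Type*) [Field K] {σ : Type*} (Z : (σ →₀ ℕ) → Prop)
    [DecidablePred Z] : MvPolynomial σ K →ₗ[K] MvPolynomial σ K :=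
  (basisMonomials σ K).constr K fun m => if Z m then monomial m 1 else 0

variable {K : Type*} [Field K] {σ : Type*} {Z : (σ →₀ ℕ) → Prop} [DecidablePred Z]

theorem monomialProj_monomial (m : σ →₀ ℕ) (c : K) :
    monomialProj K Z (monomial m c) = if Z m then monomial m c else 0 := by
  have h : (monomial m c : MvPolynomial σ K) = c • basisMonomials σ K m := by
    simp [smul_monomial]
  rw [h, map_smul, monomialProj, Module.Basis.constr_basis]
  split_ifs <;> simp [smul_monomial]

theorem coeff_monomialProj (m : σ →₀ ℕ) (f : MvPolynomial σ K) :
    coeff m (monomialProj K Z f) = if Z m then coeff m f else 0 := by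
  classical
  induction f using MvPolynomial.induction_on' with
  | monomial u a =>
    rw [monomialProj_monomial]
    split_ifs with h1 h2 h2
    · rfl
    · rw [coeff_monomial, if_neg]; rintro rfl; exact h2 h1
    · rw [coeff_zero, coeff_monomial, if_neg]; rintro rfl; exact h1 h2
    · simp
  | add p q hp hq => rw [map_add, coeff_add, hp, hq, coeff_add]; split_ifs <;> simp

theorem monomialProj_eq_zero_iff (f : MvPolynomial σ K) :
    monomialProj K Z f = 0 ↔ ∀ m, coeff m f ≠ 0 → ¬ Z m := by
  simp only [MvPolynomial.ext_iff, coeff_monomialProj, coeff_zero, ite_eq_right_iff]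
  exact forall_congr' fun m => by tauto

/-- Projection onto a face of a monoid of exponents is multiplicative. -/
theorem monomialProj_mul {P : (σ →₀ ℕ) → Prop}
    (hZ : ∀ m n, P m → P n → (Z (m + n) ↔ Z m ∧ Z n)) {f g : MvPolynomial σ K}
    (hf : ∀ m, coeff m f ≠ 0 → P m) (hg : ∀ m, coeff m g ≠ 0 → P m) :
    monomialProj K Z (f * g) = monomialProj K Z f * monomialProj K Z g := by
  rw [f.as_sum, g.as_sum, Finset.sum_mul_sum, map_sum, map_sum, map_sum, Finset.sum_mul_sum]
  refine Finset.sum_congr rfl fun m hm => ?_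
  rw [map_sum]
  refine Finset.sum_congr rfl fun n hn => ?_
  rw [monomial_mul, monomialProj_monomial, monomialProj_monomial, monomialProj_monomial]
  have := hZ m n (hf m (mem_support_iff.mp hm)) (hg n (mem_support_iff.mp hn))
  split_ifs <;> simp_all [monomial_mul]

end Faces

end SymbolicFiber

namespace SymbolicFiber

/-! ### Order of vanishing along codimension-two coordinate subspaces -/

section SymbolicPowers

theorem mem_symbolicPower_iff {R : Type*} [CommRing R] (I : Ideal R) (k : ℕ) (f : R) :
    f ∈ symbolicPower I k ↔ ∃ w ∈ assPrimesCompl I, w * f ∈ I ^ k := by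
  rw [symbolicPower, Ideal.mem_comap,
    IsLocalization.algebraMap_mem_map_algebraMap_iff (assPrimesCompl I)]

open MvPolynomial

variable {K : Type*} [Field K] {V : Type*}

theorem mem_span_X_pair_iff {u v : V} {f : MvPolynomial V K} :
    f ∈ Ideal.span {X u, X v} ↔ ∀ m, coeff m f ≠ 0 → 1 ≤ m u + m v := by
  rw [← Set.image_pair, mem_ideal_span_X_image]
  refine forall_congr' fun m => ?_
  simp only [mem_support_iff, Set.mem_insert_iff, Set.mem_singleton_iff, exists_eq_or_imp,
    exists_eq_left]
  exact imp_congr_right fun _ => by omega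

/-- The homomorphism recording the weighted degree of a polynomial in an extra variable. -/
noncomputable def weightHom (K : Type*) [Field K] (w : V → ℕ) :
    MvPolynomial V K →ₐ[K] Polynomial (MvPolynomial V K) :=
  aeval fun i => Polynomial.C (X i) * Polynomial.X ^ w i

theorem weightHom_monomial (w : V → ℕ) (m : V →₀ ℕ) (c : K) :
    weightHom K w (monomial m c) = Polynomial.monomial (Finsupp.weight w m) (monomial m c) := by
  rw [weightHom, aeval_monomial, ← Polynomial.C_mul_X_pow_eq_monomial, monomial_eq]
  simp only [mul_pow, Finsupp.prod_mul, ← pow_mul, Polynomial.algebraMap_apply,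
    MvPolynomial.algebraMap_eq, map_mul, Finsupp.weight_apply]
  rw [mul_assoc]
  congr 2
  · simp only [Finsupp.prod, map_prod, map_pow]
  · simp only [Finsupp.prod, Finsupp.sum, Finset.prod_pow_eq_pow_sum, smul_eq_mul, mul_comm]

theorem coeff_coeff_weightHom (w : V → ℕ) (f : MvPolynomial V K) (n : ℕ) (m : V →₀ ℕ) :
    coeff m ((weightHom K w f).coeff n) = if Finsupp.weight w m = n then coeff m f else 0 := by
  classical
  induction f using MvPolynomial.induction_on' with
  | monomial u a =>
    rw [weightHom_monomial, Polynomial.coeff_monomial]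
    split_ifs with h1 h2 h2
    · rfl
    · rw [coeff_monomial, if_neg]; rintro rfl; exact h2 h1
    · rw [coeff_monomial, coeff_zero, if_neg]; rintro rfl; exact h1 h2
    · simp
  | add p q hp hq =>
    rw [map_add, Polynomial.coeff_add, coeff_add, hp, hq, coeff_add]; split_ifs <;> simp

theorem X_pow_dvd_weightHom_iff (w : V → ℕ) (f : MvPolynomial V K) (k : ℕ) :
    Polynomial.X ^ k ∣ weightHom K w f ↔ ∀ m, coeff m f ≠ 0 → k ≤ Finsupp.weight w m := by
  simp only [Polynomial.X_pow_dvd_iff, MvPolynomial.ext_iff, coeff_coeff_weightHom, coeff_zero,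
    ite_eq_right_iff]
  constructor
  · intro h m hm
    by_contra! hlt
    exact hm (h _ hlt m rfl)
  · rintro h d hd m rfl
    by_contra hm
    exact absurd (h m hm) (by omega)

theorem exists_weight_eq_add (u v : V) :
    ∃ w : V → ℕ, ∀ m : V →₀ ℕ, Finsupp.weight w m = m u + m v := by
  classical
  refine ⟨Pi.single u 1 + Pi.single v 1, fun m => ?_⟩
  rw [Finsupp.weight_apply, Finsupp.sum_of_support_subset m
    (s := m.support ∪ {u, v}) Finset.subset_union_left _ (by simp)]
  simp only [Pi.add_apply, smul_eq_mul, mul_add, Finset.sum_add_distrib, Pi.single_apply,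
    mul_ite, mul_one, mul_zero]
  simp

theorem mem_span_X_pair_iff_dvd {u v : V} {w : V → ℕ}
    (hw : ∀ m : V →₀ ℕ, Finsupp.weight w m = m u + m v) {f : MvPolynomial V K} :
    f ∈ Ideal.span {X u, X v} ↔ Polynomial.X ∣ weightHom K w f := by
  rw [mem_span_X_pair_iff, ← pow_one Polynomial.X, X_pow_dvd_weightHom_iff]
  simp only [hw]

/-- It is the preimage of the prime ideal `(t)` under `weightHom` for the weight `m u + m v`. -/
theorem isPrime_span_X_pair (u v : V) :
    (Ideal.span {X u, X v} : Ideal (MvPolynomial V K)).IsPrime := by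
  obtain ⟨w, hw⟩ := exists_weight_eq_add u v
  have heq : (Ideal.span {X u, X v} : Ideal (MvPolynomial V K)) =
      (Ideal.span {Polynomial.X}).comap (weightHom K w) := by
    ext f
    rw [Ideal.mem_comap, Ideal.mem_span_singleton, mem_span_X_pair_iff_dvd hw]
  have : (Ideal.span {(Polynomial.X : Polynomial (MvPolynomial V K))}).IsPrime :=
    (Ideal.span_singleton_prime Polynomial.X_ne_zero).mpr Polynomial.prime_X
  rw [heq]
  exact Ideal.comap_isPrime _ _

/-- Symbolic powers of the ideal of a coordinate subspace of codimension two: multiplication by an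
element outside of it does not change the order of vanishing. -/
theorem le_add_of_mul_mem_pow {u v : V} {k : ℕ} {w f : MvPolynomial V K}
    (hw : w ∉ Ideal.span {X u, X v}) (h : w * f ∈ (Ideal.span {X u, X v}) ^ k) (m : V →₀ ℕ)
    (hm : coeff m f ≠ 0) : k ≤ m u + m v := by
  obtain ⟨d, hd⟩ := exists_weight_eq_add u v
  rw [mem_span_X_pair_iff_dvd hd] at hw
  have h1 : Polynomial.X ^ k ∣ weightHom K d (w * f) := by
    have hle : (Ideal.span {X u, X v} : Ideal (MvPolynomial V K)) ≤
        (Ideal.span {Polynomial.X}).comap (weightHom K d) := fun g hg => by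
      rw [Ideal.mem_comap, Ideal.mem_span_singleton]
      exact (mem_span_X_pair_iff_dvd hd).mp hg
    have := (Ideal.pow_right_mono hle k).trans (Ideal.le_comap_pow _ k) h
    rwa [Ideal.mem_comap, Ideal.span_singleton_pow, Ideal.mem_span_singleton] at this
  rw [map_mul] at h1
  have h2 := Polynomial.prime_X.pow_dvd_of_dvd_mul_left k hw h1
  rw [← hd]
  exact (X_pow_dvd_weightHom_iff d f k).mp h2 m hm

end SymbolicPowers

/-! ### Associated primes and symbolic powers of the cover ideal -/

section CoverIdeal

open MvPolynomial

variable {K : Type*} [Field K] {V : Type*} {G : SimpleGraph V}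

theorem mem_coverIdeal_iff {f : MvPolynomial V K} :
    f ∈ coverIdeal K G ↔ ∀ u v, G.Adj u v → f ∈ Ideal.span {X u, X v} := by
  simp [coverIdeal]

/-- A `k`-cover of a graph: a weighting of the vertices whose sum along each edge is at least
`k`. -/
def IsCover (G : SimpleGraph V) (k : ℕ) (α : V →₀ ℕ) : Prop :=
  ∀ u v, G.Adj u v → k ≤ α u + α v

variable [Fintype V]

open Classical in
/-- The product of the variables outside of a pair of vertices. -/
noncomputable def pairComplMonomial (K : Type*) [Field K] (u v : V) : MvPolynomial V K :=
  monomial (Finsupp.equivFunOnFinite.symm fun i => if i = u ∨ i = v then 0 else 1) 1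

theorem pairComplMonomial_notMem (u v : V) :
    pairComplMonomial K u v ∉ Ideal.span {X u, X v} := by
  classical
  rw [mem_span_X_pair_iff]
  intro h
  have := h _ (by rw [pairComplMonomial, coeff_monomial, if_pos rfl]; exact one_ne_zero)
  simp at this

/-- An edge other than `{u, v}` has an endpoint outside the pair, and the edge `{u, v}` contains
`a`. -/
theorem pairComplMonomial_mul_mem {u v a : V} (ha : a = u ∨ a = v) :
    pairComplMonomial K u v * X a ∈ coverIdeal K G := by
  classical
  refine mem_coverIdeal_iff.mpr fun i j hij => mem_span_X_pair_iff.mpr fun m hm => ?_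
  rw [pairComplMonomial, X, monomial_mul, coeff_monomial] at hm
  split_ifs at hm with h
  · subst h
    simp only [Finsupp.add_apply, Finsupp.equivFunOnFinite_symm_apply_apply, Finsupp.single_apply]
    have := hij.ne
    by_contra! hlt
    split_ifs at hlt <;> grind
  · exact absurd rfl hm

theorem mem_span_X_pair_iff_mul_mem {u v : V} (h : G.Adj u v) {f : MvPolynomial V K} :
    f ∈ Ideal.span {X u, X v} ↔ f * pairComplMonomial K u v ∈ coverIdeal K G := by
  constructor
  · intro hf
    rw [mul_comm]
    obtain ⟨a, b, rfl⟩ := Ideal.mem_span_pair.mp hf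
    rw [mul_add, mul_left_comm, mul_left_comm _ b]
    exact Ideal.add_mem _ (Ideal.mul_mem_left _ _ (pairComplMonomial_mul_mem (Or.inl rfl)))
      (Ideal.mul_mem_left _ _ (pairComplMonomial_mul_mem (Or.inr rfl)))
  · intro hf
    exact ((isPrime_span_X_pair u v).mem_or_mem (mem_coverIdeal_iff.mp hf u v h)).resolve_right
      (pairComplMonomial_notMem u v)

theorem span_X_pair_mem_associatedPrimes {u v : V} (h : G.Adj u v) :
    Ideal.span {X u, X v} ∈ associatedPrimes (MvPolynomial V K)
      (MvPolynomial V K ⧸ coverIdeal K G) := by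
  have hp := isPrime_span_X_pair (K := K) u v
  refine isAssociatedPrime_iff.mpr ⟨hp, Ideal.Quotient.mk _ (pairComplMonomial K u v), ?_⟩
  ext f
  rw [Submodule.mem_colon_singleton, Submodule.mem_bot, mem_span_X_pair_iff_mul_mem h,
    ← Ideal.Quotient.eq_zero_iff_mem, map_mul]
  rfl

/-- Such a prime is `(J : g)`, the intersection of the edge primes not containing `g`; a prime
containing a finite intersection contains one of its members. -/
theorem exists_eq_span_X_pair_of_mem_associatedPrimes {p : Ideal (MvPolynomial V K)}
    (hp : p ∈ associatedPrimes (MvPolynomial V K) (MvPolynomial V K ⧸ coverIdeal K G)) :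
    ∃ u v, G.Adj u v ∧ p = Ideal.span {X u, X v} := by
  classical
  obtain ⟨hprime, x, hx⟩ := isAssociatedPrime_iff.mp hp
  obtain ⟨g, rfl⟩ := Ideal.Quotient.mk_surjective x
  have hmem : ∀ f, f ∈ p ↔ f * g ∈ coverIdeal K G := fun f => by
    rw [hx, Submodule.mem_colon_singleton, Submodule.mem_bot, ← Ideal.Quotient.eq_zero_iff_mem,
      map_mul]
    rfl
  let s : Finset (V × V) := Finset.univ.filter fun e =>
    G.Adj e.1 e.2 ∧ g ∉ (Ideal.span {X e.1, X e.2} : Ideal (MvPolynomial V K))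
  have hinf : s.inf (fun e => (Ideal.span {X e.1, X e.2} : Ideal (MvPolynomial V K))) ≤ p := by
    intro f hf
    rw [hmem, mem_coverIdeal_iff]
    intro u v huv
    by_cases hg : g ∈ (Ideal.span {X u, X v} : Ideal (MvPolynomial V K))
    · exact Ideal.mul_mem_left _ _ hg
    · have he : (u, v) ∈ s := Finset.mem_filter.mpr ⟨Finset.mem_univ _, huv, hg⟩
      have hle := Finset.inf_le
        (f := fun e : V × V => (Ideal.span {X e.1, X e.2} : Ideal (MvPolynomial V K))) he
      exact Ideal.mul_mem_right _ _ (hle hf)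
  obtain ⟨⟨u, v⟩, he, hle⟩ := hprime.inf_le'.mp hinf
  obtain ⟨-, huv, hg⟩ := Finset.mem_filter.mp he
  refine ⟨u, v, huv, le_antisymm (fun f hf => ?_) hle⟩
  exact ((isPrime_span_X_pair u v).mem_or_mem
    (mem_coverIdeal_iff.mp ((hmem f).mp hf) u v huv)).resolve_right hg

theorem mem_assPrimesCompl_coverIdeal_iff {w : MvPolynomial V K} :
    w ∈ assPrimesCompl (coverIdeal K G) ↔
      ∀ u v, G.Adj u v → w ∉ Ideal.span {X u, X v} := by
  constructor
  · exact fun h u v huv => h _ (span_X_pair_mem_associatedPrimes huv)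
  · intro h p hp
    obtain ⟨u, v, huv, rfl⟩ := exists_eq_span_X_pair_of_mem_associatedPrimes hp
    exact h u v huv

theorem isCover_of_coeff_ne_zero_of_mem_symbolicPower {k : ℕ} {f : MvPolynomial V K}
    (hf : f ∈ symbolicPower (coverIdeal K G) k) (m : V →₀ ℕ) (hm : coeff m f ≠ 0) :
    IsCover G k m := by
  intro u v huv
  obtain ⟨w, hw, hwf⟩ := (mem_symbolicPower_iff _ _ _).mp hf
  refine le_add_of_mul_mem_pow (mem_assPrimesCompl_coverIdeal_iff.mp hw u v huv)
    (Ideal.pow_right_mono (fun g hg => ?_) k hwf) m hm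
  exact mem_coverIdeal_iff.mp hg u v huv

/-- Each of the `m u + m v` factors `X u` or `X v` of the monomial pairs with one copy of the
complementary monomial to give an element of the cover ideal. -/
theorem pairComplMonomial_pow_mul_monomial_mem {u v : V} (huv : u ≠ v) {k : ℕ} {m : V →₀ ℕ}
    (hk : k ≤ m u + m v) :
    pairComplMonomial K u v ^ (m u + m v) * monomial m 1 ∈ coverIdeal K G ^ k := by
  classical
  have hm : monomial m (1 : K) = X u ^ m u * X v ^ m v *
      monomial (m - (Finsupp.single u (m u) + Finsupp.single v (m v))) 1 := by
    rw [X_pow_eq_monomial, X_pow_eq_monomial, monomial_mul, monomial_mul, mul_one, mul_one]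
    congr 1
    rw [add_tsub_cancel_of_le]
    intro i
    simp only [Finsupp.add_apply, Finsupp.single_apply]
    split_ifs <;> grind
  have : pairComplMonomial K u v ^ (m u + m v) * monomial m 1 =
      (pairComplMonomial K u v * X u) ^ m u * (pairComplMonomial K u v * X v) ^ m v *
      monomial (m - (Finsupp.single u (m u) + Finsupp.single v (m v))) 1 := by
    rw [hm]; ring
  rw [this]
  refine Ideal.pow_le_pow_right hk (Ideal.mul_mem_right _ _ ?_)
  rw [pow_add]
  exact Ideal.mul_mem_mul (Ideal.pow_mem_pow (pairComplMonomial_mul_mem (Or.inl rfl)) _)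
    (Ideal.pow_mem_pow (pairComplMonomial_mul_mem (Or.inr rfl)) _)

/-- For each edge, the colon ideal of `J ^ k` by the monomial contains a power of an element outside
that edge prime. Prime avoidance then supplies one multiplier outside all edge primes at once. -/
theorem monomial_mem_symbolicPower {k : ℕ} {m : V →₀ ℕ} (hm : IsCover G k m) :
    monomial m 1 ∈ symbolicPower (coverIdeal K G) k := by
  classical
  rw [mem_symbolicPower_iff]
  let s : Finset (V × V) := Finset.univ.filter fun e => G.Adj e.1 e.2
  let I : Ideal (MvPolynomial V K) := (coverIdeal K G ^ k).colon {monomial m 1}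
  have hI : ¬ ((I : Set (MvPolynomial V K)) ⊆ ⋃ e ∈ (↑s : Set (V × V)),
      (Ideal.span {X e.1, X e.2} : Ideal (MvPolynomial V K))) := by
    rcases isEmpty_or_nonempty V with hV | ⟨⟨a⟩⟩
    · have : s = ∅ := by ext e; exact hV.elim e.1
      rw [this]
      simp only [Finset.coe_empty, Set.mem_empty_iff_false, Set.iUnion_of_empty]
      intro h
      exact h I.zero_mem
    -- The two exceptional indices allowed by prime avoidance are placeholders: every ideal here is
    -- prime.
    rw [Ideal.subset_union_prime (a, a) (a, a)]
    · rintro ⟨⟨u, v⟩, he, hle⟩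
      have huv : G.Adj u v := (Finset.mem_filter.mp he).2
      have := hle (Submodule.mem_colon_singleton.mpr
        (pairComplMonomial_pow_mul_monomial_mem (K := K) (G := G) huv.ne (hm u v huv)))
      exact pairComplMonomial_notMem u v ((isPrime_span_X_pair u v).mem_of_pow_mem _ this)
    · rintro ⟨u, v⟩ - - -
      exact isPrime_span_X_pair u v
  obtain ⟨w, hw, hw'⟩ := Set.not_subset.mp hI
  refine ⟨w, mem_assPrimesCompl_coverIdeal_iff.mpr fun u v huv h => hw' ?_,
    Submodule.mem_colon_singleton.mp hw⟩
  exact Set.mem_biUnion (show (u, v) ∈ (↑s : Set (V × V)) by simpa [s] using huv) h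

end CoverIdeal

end SymbolicFiber

namespace SymbolicFiber

/-! ### The Rees algebra as a monoid algebra of covers; primes from faces -/

section ReesAlgebra

open MvPolynomial

variable {K : Type*} [Field K] {V : Type*}

theorem coeff_optionEquivLeft_symm (f : Polynomial (MvPolynomial V K)) (m : Option V →₀ ℕ) :
    coeff m ((optionEquivLeft K V).symm f) = coeff m.some (f.coeff (m none)) := by
  rw [← optionEquivLeft_coeff_some_coeff_none, AlgEquiv.apply_symm_apply]

variable [Fintype V] {G : SimpleGraph V}

theorem mem_symbolicPower_coverIdeal_iff {k : ℕ} {f : MvPolynomial V K} :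
    f ∈ symbolicPower (coverIdeal K G) k ↔ ∀ m, coeff m f ≠ 0 → IsCover G k m := by
  refine ⟨isCover_of_coeff_ne_zero_of_mem_symbolicPower, fun h => ?_⟩
  rw [f.as_sum]
  refine Ideal.sum_mem _ fun m hm => ?_
  rw [← mul_one (coeff m f), ← C_mul_monomial]
  exact Ideal.mul_mem_left _ _ (monomial_mem_symbolicPower (h m (mem_support_iff.mp hm)))

theorem mem_symbolicReesAlgebra_coverIdeal_iff {f : Polynomial (MvPolynomial V K)} :
    f ∈ symbolicReesAlgebra (coverIdeal K G) ↔
      ∀ k m, coeff m (f.coeff k) ≠ 0 → IsCover G k m :=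
  forall_congr' fun _ => mem_symbolicPower_coverIdeal_iff

theorem monomial_monomial_mem_symbolicReesAlgebra {k : ℕ} {m : V →₀ ℕ} (h : IsCover G k m)
    (c : K) : Polynomial.monomial k (monomial m c) ∈ symbolicReesAlgebra (coverIdeal K G) := by
  classical
  refine mem_symbolicReesAlgebra_coverIdeal_iff.mpr fun l n hn => ?_
  rw [Polynomial.coeff_monomial] at hn
  split_ifs at hn with hl
  · rw [coeff_monomial] at hn
    split_ifs at hn with hmn
    · rwa [← hl, ← hmn]
    · exact absurd rfl hn
  · exact absurd (coeff_zero _) hn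

theorem isCover_of_coeff_optionEquivLeft_symm {f : Polynomial (MvPolynomial V K)}
    (hf : f ∈ symbolicReesAlgebra (coverIdeal K G)) (m : Option V →₀ ℕ)
    (hm : coeff m ((optionEquivLeft K V).symm f) ≠ 0) : IsCover G (m none) m.some :=
  mem_symbolicReesAlgebra_coverIdeal_iff.mp hf _ _ (by rwa [← coeff_optionEquivLeft_symm])

open Classical in
/-- The homomorphism from the symbolic Rees algebra that kills all monomials outside of a face `Z`
of the monoid of covers. -/
noncomputable def faceHom (K : Type*) [Field K] {Z : (Option V →₀ ℕ) → Prop}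
    (hZ : ∀ m n, IsCover G (m none) m.some → IsCover G (n none) n.some →
      (Z (m + n) ↔ Z m ∧ Z n)) (h0 : Z 0) :
    symbolicReesAlgebra (coverIdeal K G) →+* MvPolynomial (Option V) K where
  toFun f := monomialProj K Z ((optionEquivLeft K V).symm f)
  map_one' := by
    rw [OneMemClass.coe_one, map_one, ← C_1, ← monomial_zero', monomialProj_monomial, if_pos h0]
  map_mul' f g := by
    rw [MulMemClass.coe_mul, map_mul]
    exact monomialProj_mul hZ (isCover_of_coeff_optionEquivLeft_symm f.2)
      (isCover_of_coeff_optionEquivLeft_symm g.2)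
  map_zero' := by simp
  map_add' f g := by simp

theorem mem_ker_faceHom_iff {Z : (Option V →₀ ℕ) → Prop}
    (hZ : ∀ m n, IsCover G (m none) m.some → IsCover G (n none) n.some →
      (Z (m + n) ↔ Z m ∧ Z n)) (h0 : Z 0) {f : symbolicReesAlgebra (coverIdeal K G)} :
    f ∈ RingHom.ker (faceHom K hZ h0) ↔
      ∀ m, coeff m ((optionEquivLeft K V).symm f) ≠ 0 → ¬ Z m := by
  classical
  rw [RingHom.mem_ker]
  exact monomialProj_eq_zero_iff _

theorem map_irrelevantIdeal_le_ker_faceHom {Z : (Option V →₀ ℕ) → Prop}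
    (hZ : ∀ m n, IsCover G (m none) m.some → IsCover G (n none) n.some →
      (Z (m + n) ↔ Z m ∧ Z n)) (h0 : Z 0) (hX : ∀ v, ¬ Z (Finsupp.single (some v) 1)) :
    (irrelevantIdeal K V).map
      (algebraMap (MvPolynomial V K) (symbolicReesAlgebra (coverIdeal K G))) ≤
      RingHom.ker (faceHom K hZ h0) := by
  classical
  rw [irrelevantIdeal, Ideal.map_span, Ideal.span_le]
  rintro _ ⟨_, ⟨v, rfl⟩, rfl⟩
  refine (mem_ker_faceHom_iff hZ h0).mpr fun m hm => ?_
  have : ((algebraMap (MvPolynomial V K) (symbolicReesAlgebra (coverIdeal K G)) (X v) :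
      symbolicReesAlgebra (coverIdeal K G)) : Polynomial (MvPolynomial V K)) =
      Polynomial.C (X v) := rfl
  rw [this, optionEquivLeft_symm_C_X, X, coeff_monomial] at hm
  split_ifs at hm with h
  · rw [← h]; exact hX v
  · exact absurd rfl hm

/-- A strictly increasing chain of faces of the monoid of covers that avoid the variables bounds
the dimension of the symbolic fiber cone from below. -/
theorem le_ringKrullDim_symbolicFiberCone_of_faces {n : ℕ}
    (Z : Fin (n + 1) → (Option V →₀ ℕ) → Prop)
    (hZ : ∀ i m m', IsCover G (m none) m.some → IsCover G (m' none) m'.some →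
      (Z i (m + m') ↔ Z i m ∧ Z i m')) (h0 : ∀ i, Z i 0)
    (hX : ∀ i v, ¬ Z i (Finsupp.single (some v) 1))
    (hle : ∀ (i : Fin n) m, Z i.castSucc m → Z i.succ m)
    (y : Fin n → Option V →₀ ℕ) (hy : ∀ i, IsCover G (y i none) (y i).some)
    (hyZ : ∀ i, Z i.succ (y i)) (hyZ' : ∀ i, ¬ Z i.castSucc (y i)) :
    (n : WithBot ℕ∞) ≤ ringKrullDim (symbolicFiberCone K G) := by
  classical
  rw [ringKrullDim_quotient, Order.le_krullDim_iff]
  let P : Fin (n + 1) → PrimeSpectrum.zeroLocus (R := symbolicReesAlgebra (coverIdeal K G))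
      ((irrelevantIdeal K V).map
        (algebraMap (MvPolynomial V K) (symbolicReesAlgebra (coverIdeal K G)))) := fun i =>
    ⟨⟨RingHom.ker (faceHom K (hZ i) (h0 i)), RingHom.ker_isPrime _⟩,
      map_irrelevantIdeal_le_ker_faceHom (hZ i) (h0 i) (hX i)⟩
  -- A larger face gives a smaller kernel; the monomial of `y i` makes the inclusion strict.
  have hP : StrictAnti P := by
    rw [Fin.strictAnti_iff_succ_lt]
    intro i
    change RingHom.ker (faceHom K (hZ i.succ) (h0 i.succ)) <
      RingHom.ker (faceHom K (hZ i.castSucc) (h0 i.castSucc))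
    refine SetLike.lt_iff_le_and_exists.mpr ⟨fun f hf => ?_, ?_⟩
    · rw [mem_ker_faceHom_iff] at hf ⊢
      exact fun m hm h => hf m hm (hle i m h)
    · have hcoeff : ∀ m, coeff m ((optionEquivLeft K V).symm (Polynomial.monomial (y i none)
          (monomial (y i).some (1 : K)))) = if y i = m then 1 else 0 := by
        intro m
        rw [← optionEquivLeft_monomial, AlgEquiv.symm_apply_apply, coeff_monomial]
      refine ⟨⟨_, monomial_monomial_mem_symbolicReesAlgebra (hy i) 1⟩, ?_, ?_⟩
      · rw [mem_ker_faceHom_iff]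
        intro m hm
        rw [hcoeff] at hm
        split_ifs at hm with h
        · rw [← h]; exact hyZ' i
        · exact absurd rfl hm
      · rw [mem_ker_faceHom_iff]
        intro h
        refine h (y i) ?_ (hyZ i)
        rw [hcoeff, if_pos rfl]
        exact one_ne_zero
  exact ⟨LTSeries.mk n (P ∘ Fin.rev) (hP.comp Fin.rev_strictAnti), rfl⟩

end ReesAlgebra

/-! ### Basic covers -/

section BasicCovers

variable {V : Type*} {G : SimpleGraph V}

theorem IsCover.sub_single {k : ℕ} {α : V →₀ ℕ} (hα : IsCover G k α) {v : V}
    (h : ∀ w, G.Adj v w → α v + α w ≠ k) : IsCover G k (α - Finsupp.single v 1) := by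
  classical
  intro u w huw
  have h1 := hα u w huw
  have h2 := huw.ne
  simp only [Finsupp.tsub_apply, Finsupp.single_apply]
  split_ifs with h3 h4 h4
  · exact absurd (h3.symm.trans h4) h2
  · subst h3; have := h w huw; omega
  · subst h4; have := h u huw.symm; omega
  · simpa using h1

/-- If `α v = 0`, any neighbour `w` has `α w ≥ k`. A nonzero `α w` is at most `k` by its own tight
edge, and if `α w = 0` then `k = 0`. -/
theorem IsCover.exists_adj_add_eq (hG : ∀ v : V, ∃ w : V, G.Adj v w) {k : ℕ} {α : V →₀ ℕ}
    (hα : IsCover G k α) (h : ∀ v, α v ≠ 0 → ∃ w, G.Adj v w ∧ α v + α w = k) (v : V) :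
    ∃ w, G.Adj v w ∧ α v + α w = k := by
  by_cases hv : α v = 0
  · obtain ⟨w, hw⟩ := hG v
    refine ⟨w, hw, ?_⟩
    have h1 := hα v w hw
    by_cases hw0 : α w = 0
    · omega
    · obtain ⟨u, -, hu⟩ := h w hw0
      omega
  · exact h v hv

theorem IsCover.exists_adj_add_eq_of_minimal (hG : ∀ v : V, ∃ w : V, G.Adj v w) {k : ℕ}
    {α : V →₀ ℕ} (hα : Minimal (IsCover G k) α) (v : V) :
    ∃ w, G.Adj v w ∧ α v + α w = k := by
  classical
  refine hα.prop.exists_adj_add_eq hG (fun v hv => ?_) v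
  by_contra! hne
  have h1 := hα.le_of_le (hα.prop.sub_single hne) tsub_le_self v
  simp only [Finsupp.tsub_apply, Finsupp.single_eq_same] at h1
  omega

variable [Finite V]

/-- A basic `(2 r + 2)`-cover with prescribed pairwise distinct values on a free parameter set. -/
theorem exists_isCover_of_freeParameters (hG : ∀ v : V, ∃ w : V, G.Adj v w) {r : ℕ}
    {a b : Fin r → V} (ha : Function.Injective a) (hb : Function.Injective b)
    (hind : ∀ i j, ¬ G.Adj (a i) (a j)) (hab : ∀ i j, a i ≠ b j)
    (hadj : ∀ i, G.Adj (a i) (b i)) (hle : ∀ i j, G.Adj (a i) (b j) → i ≤ j) :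
    ∃ α : V →₀ ℕ, IsCover G (2 * r + 2) α ∧ (∀ v, ∃ w, G.Adj v w ∧ α v + α w = 2 * r + 2) ∧
      ∀ j, α (a j) + j = r := by
  -- The values at `a j` and `b j` sum to `2 * r + 2`. All vertices outside `a` get at least `r +
  -- 2`, so only edges meeting `a` need the order condition `i ≤ j`.
  let β : V → ℕ := Function.extend a (fun j => r - (j : ℕ))
    (Function.extend b (fun j => r + 2 + (j : ℕ)) fun _ => 2 * r + 2)
  have hβa : ∀ j, β (a j) = r - (j : ℕ) := fun j => ha.extend_apply _ _ j
  have hβb : ∀ j, β (b j) = r + 2 + (j : ℕ) := fun j => by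
    have : ¬ ∃ i, a i = b j := fun ⟨i, hi⟩ => hab i j hi
    rw [show β (b j) = _ from Function.extend_apply' _ _ _ this]
    exact hb.extend_apply _ _ j
  have hβo : ∀ v, (¬ ∃ i, a i = v) → (¬ ∃ j, b j = v) → β v = 2 * r + 2 := fun v h1 h2 => by
    rw [show β v = _ from Function.extend_apply' _ _ _ h1]
    exact Function.extend_apply' _ _ _ h2
  have hβ' : ∀ v, (¬ ∃ i, a i = v) → r + 2 ≤ β v := fun v h => by
    by_cases h' : ∃ j, b j = v
    · obtain ⟨j, rfl⟩ := h'
      rw [hβb]; omega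
    · rw [hβo v h h']; omega
  have hcov' : ∀ i v, G.Adj (a i) v → 2 * r + 2 ≤ β (a i) + β v := fun i v h => by
    by_cases h1 : ∃ j, a j = v
    · obtain ⟨j, rfl⟩ := h1
      exact absurd h (hind i j)
    by_cases h2 : ∃ j, b j = v
    · obtain ⟨j, rfl⟩ := h2
      have : (i : ℕ) ≤ j := hle i j h
      rw [hβa, hβb]; omega
    · rw [hβo v h1 h2]; omega
  have hcov : IsCover G (2 * r + 2) (Finsupp.equivFunOnFinite.symm β) := by
    intro u v huv
    simp only [Finsupp.equivFunOnFinite_symm_apply_apply]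
    by_cases hu : ∃ i, a i = u
    · obtain ⟨i, rfl⟩ := hu
      exact hcov' i v huv
    by_cases hv : ∃ i, a i = v
    · obtain ⟨i, rfl⟩ := hv
      rw [add_comm (β u)]
      exact hcov' i u huv.symm
    have := hβ' u hu
    have := hβ' v hv
    omega
  obtain ⟨α, hαβ, hα⟩ := exists_minimal_le_of_wellFoundedLT (IsCover G (2 * r + 2)) _ hcov
  refine ⟨α, hα.prop, IsCover.exists_adj_add_eq_of_minimal hG hα, fun j => ?_⟩
  have h1 := hαβ (a j)
  have h2 := hαβ (b j)
  -- The edge from `a j` to `b j` is tight for `β`, so a smaller cover cannot drop at either end.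
  have h3 := hα.prop _ _ (hadj j)
  simp only [Finsupp.equivFunOnFinite_symm_apply_apply, hβa, hβb] at h1 h2
  omega

end BasicCovers

/-! ### Lower bound: a chain of faces from a free parameter set -/

section LowerBound

variable (K : Type*) [Field K] {V : Type*} [Fintype V] {G : SimpleGraph V}

theorem succ_le_ringKrullDim_of_freeParameters (hG : ∀ v : V, ∃ w : V, G.Adj v w) {r : ℕ}
    {a b : Fin r → V} (ha : Function.Injective a) (hb : Function.Injective b)
    (hind : ∀ i j, ¬ G.Adj (a i) (a j)) (hab : ∀ i j, a i ≠ b j)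
    (hadj : ∀ i, G.Adj (a i) (b i)) (hle : ∀ i j, G.Adj (a i) (b j) → i ≤ j) :
    ((r + 1 : ℕ) : WithBot ℕ∞) ≤ ringKrullDim (symbolicFiberCone K G) := by
  classical
  obtain ⟨α, hα, htight, hαa⟩ := exists_isCover_of_freeParameters hG ha hb hind hab hadj hle
  -- Tightness and vanishing cut out faces because they are equality cases of inequalities valid for
  -- all covers. The variables are excluded since each vertex lies on a tight edge of `α`.
  let Z : Fin (r + 2) → (Option V →₀ ℕ) → Prop := fun i => Fin.cases (fun m => m = 0)
    (fun i m => (∀ u v, G.Adj u v → α u + α v = 2 * r + 2 → m (some u) + m (some v) = m none) ∧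
      ∀ j : Fin r, (i : ℕ) ≤ j → m (some (a j)) = 0) i
  have hZ0 : ∀ m, Z 0 m ↔ m = 0 := fun m => Iff.rfl
  have hZs : ∀ i m, Z (Fin.succ i) m ↔
      (∀ u v, G.Adj u v → α u + α v = 2 * r + 2 → m (some u) + m (some v) = m none) ∧
      ∀ j : Fin r, (i : ℕ) ≤ j → m (some (a j)) = 0 := fun i m => Iff.rfl
  -- A monotone step function symmetric about `r + 1`, half the degree of `α`: it turns `α` into a
  -- 2-cover and keeps tight edges tight. As `i` grows the zero range shrinks, releasing one
  -- parameter at a time.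
  let g : ℕ → ℕ → ℕ := fun i c => if c + i < r + 1 then 0 else if r + 1 + i < c then 2 else 1
  let y : Fin (r + 1) → Option V →₀ ℕ := fun i =>
    Finsupp.equivFunOnFinite.symm fun o => o.elim 2 fun v => g i (α v)
  have hyn : ∀ i, y i none = 2 := fun i => rfl
  have hys : ∀ i v, y i (some v) = g i (α v) := fun i v => rfl
  clear_value Z y
  refine le_ringKrullDim_symbolicFiberCone_of_faces (n := r + 1) Z ?_ ?_ ?_ ?_ y ?_ ?_ ?_
  · intro i m m' hm hm'
    refine Fin.cases ?_ (fun i => ?_) i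
    · simp only [hZ0, add_eq_zero]
    · simp only [hZs, Finsupp.add_apply]
      constructor
      · rintro ⟨h1, h2⟩
        refine ⟨⟨fun u v huv h => ?_, fun j hj => ?_⟩, fun u v huv h => ?_, fun j hj => ?_⟩
        · have := h1 u v huv h
          have := hm u v huv
          have := hm' u v huv
          simp only [Finsupp.some_apply] at *
          omega
        · have := h2 j hj
          omega
        · have := h1 u v huv h
          have := hm u v huv
          have := hm' u v huv
          simp only [Finsupp.some_apply] at *
          omega
        · have := h2 j hj
          omega
      · rintro ⟨⟨h1, h2⟩, h3, h4⟩
        refine ⟨fun u v huv h => ?_, fun j hj => ?_⟩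
        · have := h1 u v huv h
          have := h3 u v huv h
          omega
        · rw [h2 j hj, h4 j hj]
  · intro i
    refine Fin.cases ?_ (fun i => ?_) i
    · rw [hZ0]
    · exact (hZs i 0).mpr (by simp)
  · intro i v
    refine Fin.cases ?_ (fun i => ?_) i
    · simp [hZ0]
    · rw [hZs]
      rintro ⟨h, -⟩
      obtain ⟨w, hw, hvw⟩ := htight v
      have := h v w hw hvw
      simp [Finsupp.single_apply] at this
  · intro i m
    refine Fin.cases ?_ (fun i => ?_) i
    · intro h
      rw [Fin.castSucc_zero, hZ0] at h
      exact (hZs 0 m).mpr (by simp [h])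
    · rw [← Fin.succ_castSucc, hZs, hZs]
      refine fun h => ⟨h.1, fun j hj => h.2 j ?_⟩
      simp at hj ⊢
      omega
  · intro i u v huv
    have := hα u v huv
    simp only [Finsupp.some_apply, hyn, hys, g]
    split_ifs <;> omega
  · intro i
    rw [hZs]
    refine ⟨fun u v huv h => ?_, fun j hj => ?_⟩
    · simp only [hyn, hys, g]
      split_ifs <;> omega
    · have := hαa j
      simp only [hys, g]
      rw [if_pos (by omega)]
  · intro i
    refine Fin.cases ?_ (fun i => ?_) i
    · rw [Fin.castSucc_zero, hZ0]
      intro h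
      have := hyn 0
      rw [h] at this
      simp at this
    · rw [← Fin.succ_castSucc, hZs]
      rintro ⟨-, h⟩
      have h1 := h i (by simp)
      have h2 := hαa i
      simp only [hys, g, Fin.val_succ] at h1
      split_ifs at h1
      omega

theorem gdim_le_ringKrullDim (hG : ∀ v : V, ∃ w : V, G.Adj v w) :
    ((gdim G : ℕ) : WithBot ℕ∞) ≤ ringKrullDim (symbolicFiberCone K G) := by
  classical
  rw [gdim]
  set s := Finset.univ.filter fun A : Finset V => IsFreeParameterSet G A with hs
  rcases s.eq_empty_or_nonempty with h | h
  · rw [h, Finset.sup_empty]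
    exact succ_le_ringKrullDim_of_freeParameters K hG (a := (Fin.elim0 : Fin 0 → V))
      (b := Fin.elim0) (fun i => i.elim0) (fun i => i.elim0) (fun i => i.elim0)
      (fun i => i.elim0) (fun i => i.elim0) (fun i => i.elim0)
  · obtain ⟨A, hA, hsup⟩ := Finset.exists_mem_eq_sup s h Finset.card
    rw [hsup]
    obtain ⟨-, hind, a, b, ha, hra, hb, hdisj, hadj, hle⟩ := (Finset.mem_filter.mp hA).2
    have hmem : ∀ i, a i ∈ (A : Set V) := fun i => hra ▸ Set.mem_range_self i
    refine succ_le_ringKrullDim_of_freeParameters K hG ha hb (fun i j h => ?_)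
      (fun i j h => ?_) hadj hle
    · exact hind (hmem i) (hmem j) h.ne h
    · exact Set.disjoint_left.mp hdisj (hmem i) ⟨j, h.symm⟩

end LowerBound

end SymbolicFiber

namespace SymbolicFiber

/-! ### Basic covers have few distinct values -/

section Counting

variable {V : Type*} [Fintype V] {G : SimpleGraph V}

open Classical in
/-- The values below `k / 2` of a basic `k`-cover give rise to a free parameter set. -/
theorem card_small_values_lt_gdim {k : ℕ} {α : V → ℕ}
    (hα : ∀ u v, G.Adj u v → k ≤ α u + α v) (h : ∀ v, ∃ w, G.Adj v w ∧ α v + α w = k) :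
    ((Finset.univ.image α).filter fun c => 2 * c < k).card + 1 ≤ gdim G := by
  rw [gdim]
  refine Nat.succ_le_succ ?_
  set L := (Finset.univ.image α).filter fun c => 2 * c < k with hL
  rcases Nat.eq_zero_or_pos L.card with h0 | hpos
  · omega
  -- Decreasing order: an edge from `a i` to `b j` forces `c i + (k - c j) ≥ k`, hence `c j ≤ c i`,
  -- which must mean `i ≤ j`.
  let c : Fin L.card → ℕ := fun i => L.orderEmbOfFin rfl i.rev
  have hc : ∀ {i j}, c i ≤ c j ↔ j ≤ i := fun {i j} => by
    rw [(L.orderEmbOfFin rfl).le_iff_le, Fin.rev_le_rev]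
  have hcmem : ∀ i, c i ∈ L := fun i => L.orderEmbOfFin_mem rfl _
  have hca : ∀ i, ∃ v, α v = c i := fun i => by
    simpa using (Finset.mem_filter.mp (hcmem i)).1
  have hck : ∀ i, 2 * c i < k := fun i => (Finset.mem_filter.mp (hcmem i)).2
  choose a ha using hca
  choose b hadj hb using fun i => h (a i)
  have hinj : Function.Injective a := fun i j hij => by
    have : c i = c j := by rw [← ha, ← ha, hij]
    exact le_antisymm (hc.mp this.ge) (hc.mp this.le)
  have hcard : (Finset.univ.image a).card = L.card := by
    rw [Finset.card_image_of_injective _ hinj, Finset.card_univ, Fintype.card_fin]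
  rw [← hcard]
  refine Finset.le_sup (f := Finset.card) (Finset.mem_filter.mpr ⟨Finset.mem_univ _, ?_, ?_,
    a ∘ Fin.cast hcard, b ∘ Fin.cast hcard, ?_, ?_, ?_, ?_, ?_, ?_⟩)
  · rw [← Finset.card_pos, hcard]
    exact hpos
  · simp only [Finset.coe_image, Finset.coe_univ, Set.image_univ]
    rintro _ ⟨i, rfl⟩ _ ⟨j, rfl⟩ - hij
    have := hα _ _ hij
    have := hck i
    have := hck j
    rw [ha, ha] at *
    omega
  · exact hinj.comp (Fin.cast_injective hcard)
  · have hrange : Set.range (a ∘ Fin.cast hcard) = Set.range a :=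
      (finCongr hcard).surjective.range_comp a
    simp [hrange]
  · refine Function.Injective.comp (fun i j hij => hinj ?_) (Fin.cast_injective hcard)
    have h1 := hb i
    have h2 := hb j
    rw [ha] at h1 h2
    rw [hij] at h1
    have : c i = c j := by omega
    rw [le_antisymm (hc.mp this.ge) (hc.mp this.le)]
  · rw [Set.disjoint_left]
    rintro _ hv ⟨j, rfl⟩
    simp only [Finset.coe_image, Finset.coe_univ, Set.image_univ] at hv
    obtain ⟨i, hi⟩ := hv
    have h1 := hb (Fin.cast hcard j)
    have h2 := hck i
    have h3 := hck (Fin.cast hcard j)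
    simp only [Function.comp_apply] at hi
    rw [← hi, ha, ha] at h1
    omega
  · exact fun i => hadj _
  · intro i j hij
    have h1 := hα _ _ hij
    have h2 := hb (Fin.cast hcard j)
    simp only [Function.comp_apply] at h1
    rw [ha] at h1 h2
    have h3 : c (Fin.cast hcard j) ≤ c (Fin.cast hcard i) := by omega
    exact hc.mp h3

/-- The weighting of the vertices with values in `{k / 2, c j, k - c j}` prescribed by a
labelling. -/
def weightingOfLabels {r : ℕ} (k : ℕ) (c : Fin r → ℕ) (l : V → Option (Fin r × Bool)) (v : V) : ℕ :=
  (l v).elim (k / 2) fun p => if p.2 then k - c p.1 else c p.1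

theorem exists_weightingOfLabels_eq {r k : ℕ} (hr : gdim G = r + 1) {α : V → ℕ}
    (hα : ∀ u v, G.Adj u v → k ≤ α u + α v) (h : ∀ v, ∃ w, G.Adj v w ∧ α v + α w = k) :
    ∃ (c : Fin r → Fin (k + 1)) (l : V → Option (Fin r × Bool)),
      weightingOfLabels k (fun j => (c j : ℕ)) l = α := by
  classical
  have hcard := card_small_values_lt_gdim hα h
  set L := (Finset.univ.image α).filter fun c => 2 * c < k with hL
  have hLr : L.card ≤ r := by omega
  have hLk : ∀ x ∈ L, x < k + 1 := fun x hx => by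
    have := (Finset.mem_filter.mp hx).2
    omega
  -- When there are fewer than `r` small values, the list is padded with zeros.
  let c : Fin r → Fin (k + 1) := fun j =>
    if hj : (j : ℕ) < L.card then ⟨L.orderEmbOfFin rfl ⟨j, hj⟩, hLk _ (L.orderEmbOfFin_mem rfl _)⟩
    else 0
  have hc : ∀ x ∈ L, ∃ j, (c j : ℕ) = x := by
    intro x hx
    have : x ∈ Set.range (L.orderEmbOfFin rfl) := by rw [Finset.range_orderEmbOfFin]; exact hx
    obtain ⟨i, rfl⟩ := this
    exact ⟨⟨i, i.2.trans_le hLr⟩, by simp [c]⟩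
  have hmem : ∀ v, 2 * α v < k → α v ∈ L := fun v hv =>
    Finset.mem_filter.mpr ⟨Finset.mem_image_of_mem _ (Finset.mem_univ v), hv⟩
  have hl : ∀ v, ∃ o : Option (Fin r × Bool),
      o.elim (k / 2) (fun p => if p.2 then k - (c p.1 : ℕ) else (c p.1 : ℕ)) = α v := by
    intro v
    rcases lt_trichotomy (2 * α v) k with hv | hv | hv
    · obtain ⟨j, hj⟩ := hc _ (hmem v hv)
      exact ⟨some (j, false), by simpa using hj⟩
    -- Here `2 * α v = k`, so the rounded `k / 2` is exact.
    · exact ⟨none, by simp only [Option.elim_none]; omega⟩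
    · obtain ⟨w, -, hw⟩ := h v
      obtain ⟨j, hj⟩ := hc _ (hmem w (by omega))
      refine ⟨some (j, true), ?_⟩
      simp only [Option.elim_some, if_true, hj]
      omega
  choose l hl using hl
  exact ⟨c, l, funext hl⟩

end Counting

/-! ### Upper bound: growth of the fiber cone -/

section UpperBound

open MvPolynomial

variable {K : Type*} [Field K] {V : Type*} [Fintype V] {G : SimpleGraph V}

/-- With no tight edge at `v`, lowering `m v` by one leaves a `k`-cover, so `X v` splits off inside
the Rees algebra. -/
theorem monomial_monomial_mem_map_irrelevantIdeal {k : ℕ} {m : V →₀ ℕ} (h : IsCover G k m)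
    {v : V} (hv : m v ≠ 0) (hne : ∀ w, G.Adj v w → m v + m w ≠ k) (c : K) :
    (⟨_, monomial_monomial_mem_symbolicReesAlgebra h c⟩ : symbolicReesAlgebra (coverIdeal K G)) ∈
      (irrelevantIdeal K V).map
        (algebraMap (MvPolynomial V K) (symbolicReesAlgebra (coverIdeal K G))) := by
  have heq : (⟨_, monomial_monomial_mem_symbolicReesAlgebra h c⟩ :
      symbolicReesAlgebra (coverIdeal K G)) =
      algebraMap (MvPolynomial V K) (symbolicReesAlgebra (coverIdeal K G)) (X v) *
        ⟨_, monomial_monomial_mem_symbolicReesAlgebra (h.sub_single hne) c⟩ := by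
    refine Subtype.ext ?_
    change Polynomial.monomial k (monomial m c) = Polynomial.C (X v) * Polynomial.monomial k _
    rw [Polynomial.C_mul_monomial, X, monomial_mul, one_mul, add_tsub_cancel_of_le]
    simpa [Finsupp.single_le_iff] using Nat.one_le_iff_ne_zero.mpr hv
  rw [heq]
  exact Ideal.mul_mem_right _ _ (Ideal.mem_map_of_mem _ (Ideal.subset_span ⟨v, rfl⟩))

/-- The elements of the symbolic Rees algebra of degree at most `N`. -/
noncomputable def reesDegreeLE (K : Type*) [Field K] (G : SimpleGraph V) (N : ℕ) :
    Submodule K (symbolicReesAlgebra (coverIdeal K G)) where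
  carrier := {f | (f : Polynomial (MvPolynomial V K)).natDegree ≤ N}
  add_mem' hf hg := Polynomial.natDegree_add_le_of_degree_le hf hg
  zero_mem' := by simp
  smul_mem' c f hf := (Polynomial.natDegree_smul_le c _).trans hf

/-- The image in the symbolic fiber cone of the elements of degree at most `N`. -/
noncomputable def fiberDegreeLE (K : Type*) [Field K] (G : SimpleGraph V) (N : ℕ) :
    Submodule K (symbolicFiberCone K G) :=
  (reesDegreeLE K G N).map (Ideal.Quotient.mkₐ K _).toLinearMap

open Classical in
/-- The class in the symbolic fiber cone of the monomial of a cover. -/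
noncomputable def coverClass (K : Type*) [Field K] (G : SimpleGraph V) (k : ℕ) (m : V → ℕ) :
    symbolicFiberCone K G :=
  if h : IsCover G k (Finsupp.equivFunOnFinite.symm m) then
    Ideal.Quotient.mk _ ⟨_, monomial_monomial_mem_symbolicReesAlgebra h (1 : K)⟩ else 0

/-- The classes of the covers described by labellings of the vertices. -/
noncomputable def labelledCoverClass (K : Type*) [Field K] (G : SimpleGraph V) (r N : ℕ)
    (d : Fin (N + 1) × (Fin r → Fin (N + 1)) × (V → Option (Fin r × Bool))) :
    symbolicFiberCone K G :=
  coverClass K G d.1 (weightingOfLabels d.1 (fun j => (d.2.1 j : ℕ)) d.2.2)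

theorem fiberDegreeLE_le_span (hG : ∀ v : V, ∃ w : V, G.Adj v w) {r : ℕ} (hr : gdim G = r + 1)
    (N : ℕ) : fiberDegreeLE K G N ≤ Submodule.span K (Set.range (labelledCoverClass K G r N)) := by
  classical
  set T := Submodule.span K (Set.range (labelledCoverClass K G r N)) with hT
  have hmon : ∀ (k : ℕ) (m : V →₀ ℕ) (c : K) (_ : k ≤ N) (h : IsCover G k m),
      (Ideal.Quotient.mk _ ⟨_, monomial_monomial_mem_symbolicReesAlgebra h c⟩ :
        symbolicFiberCone K G) ∈ T := by
    intro k m c hk h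
    by_cases hb : ∀ v, m v ≠ 0 → ∃ w, G.Adj v w ∧ m v + m w = k
    · obtain ⟨x, l, hxl⟩ := exists_weightingOfLabels_eq (α := m) hr h (h.exists_adj_add_eq hG hb)
      have hmem : coverClass K G k m ∈ T := by
        refine Submodule.subset_span ⟨⟨⟨k, by omega⟩, fun j => ⟨x j, by have := (x j).2; omega⟩, l⟩,
          ?_⟩
        simp only [labelledCoverClass, hxl]
      rw [coverClass, dif_pos (by simpa using h)] at hmem
      have := T.smul_mem c hmem
      convert this using 1
      rw [← Ideal.Quotient.mkₐ_eq_mk K, ← map_smul]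
      congr 1
      refine Subtype.ext ?_
      change _ = c • Polynomial.monomial k (monomial _ (1 : K))
      rw [Polynomial.smul_monomial, smul_monomial, smul_eq_mul, mul_one]
      simp
    · push Not at hb
      obtain ⟨v, hv, hne⟩ := hb
      rw [Ideal.Quotient.eq_zero_iff_mem.mpr
        (monomial_monomial_mem_map_irrelevantIdeal h hv hne c)]
      exact T.zero_mem
  rintro _ ⟨f, hf, rfl⟩
  -- The monomial expansion lives in the ambient polynomial ring, so the preimage of `T` is pushed
  -- forward there and recovered by injectivity of the inclusion.
  let T' : Submodule K (Polynomial (MvPolynomial V K)) :=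
    (T.comap (Ideal.Quotient.mkₐ K _).toLinearMap).map
      ((symbolicReesAlgebra (coverIdeal K G)).val.restrictScalars K).toLinearMap
  have hfT : (f : Polynomial (MvPolynomial V K)) ∈ T' := by
    rw [(f : Polynomial (MvPolynomial V K)).as_sum_range' (N + 1) (Nat.lt_succ_iff.mpr hf)]
    refine Submodule.sum_mem _ fun k hk => ?_
    rw [((f : Polynomial (MvPolynomial V K)).coeff k).as_sum, map_sum]
    refine Submodule.sum_mem _ fun m hm => ?_
    have hm' := mem_symbolicReesAlgebra_coverIdeal_iff.mp f.2 k m (mem_support_iff.mp hm)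
    exact ⟨⟨_, monomial_monomial_mem_symbolicReesAlgebra hm' _⟩,
      hmon k m _ (Nat.lt_succ_iff.mp (Finset.mem_range.mp hk)) hm', rfl⟩
  obtain ⟨f', hf', hff'⟩ := hfT
  have : f' = f := Subtype.ext hff'
  rw [← this]
  exact hf'

theorem ringKrullDim_symbolicFiberCone_le (K : Type*) [Field K]
    (hG : ∀ v : V, ∃ w : V, G.Adj v w) :
    ringKrullDim (symbolicFiberCone K G) ≤ (gdim G : ℕ) := by
  classical
  obtain ⟨r, hr⟩ : ∃ r, gdim G = r + 1 := ⟨_, rfl⟩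
  rw [ringKrullDim, Order.krullDim]
  refine iSup_le fun l => ?_
  obtain ⟨x, hx⟩ := exists_algebraicIndependent_of_ltSeries K (R := symbolicFiberCone K G) l
  have hspan := fiberDegreeLE_le_span (K := K) hG hr
  have hlen : l.length ≤ gdim G := by
    -- Each vertex has `2 r + 1` possible labels; the degree and the `r` values contribute the
    -- factor `(N + 1) ^ (r + 1)`.
    refine card_le_of_filtration_le_span (C := (r * 2 + 1) ^ Fintype.card V)
      (fiberDegreeLE K G) ?_ ?_ ?_ ?_ ?_ hx
    · exact fun M N hMN => Submodule.map_mono fun f hf => le_trans hf hMN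
    · exact ⟨1, (Polynomial.natDegree_one (R := MvPolynomial V K)).le, map_one (Ideal.Quotient.mk _)⟩
    · rintro m n _ _ ⟨f, hf, rfl⟩ ⟨g, hg, rfl⟩
      exact ⟨f * g, Polynomial.natDegree_mul_le_of_le hf hg, map_mul (Ideal.Quotient.mk _) _ _⟩
    · intro y
      obtain ⟨f, rfl⟩ := Ideal.Quotient.mk_surjective y
      exact ⟨(f : Polynomial (MvPolynomial V K)).natDegree, f,
        le_refl (f : Polynomial (MvPolynomial V K)).natDegree, rfl⟩
    · intro N
      refine ⟨Finset.univ.image (labelledCoverClass K G r N), Finset.card_image_le.trans ?_,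
        (hspan N).trans ?_⟩
      · simp only [Fintype.card_prod, Fintype.card_fin, Fintype.card_pi, Finset.prod_const,
          Finset.card_univ, Fintype.card_option, Fintype.card_bool, hr]
        exact le_of_eq (by ring)
      · rw [Finset.coe_image, Finset.coe_univ, Set.image_univ]
  exact_mod_cast hlen

end UpperBound

end SymbolicFiber

theorem theorem3p8 (K : Type*) [Field K] {V : Type*} [Fintype V] [Nonempty V]
    (G : SimpleGraph V) (hG : ∀ v : V, ∃ w : V, G.Adj v w) :
    ringKrullDim (SymbolicFiber.symbolicFiberCone K G) = (SymbolicFiber.gdim G : ℕ) :=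
  le_antisymm (SymbolicFiber.ringKrullDim_symbolicFiberCone_le K hG)
    (SymbolicFiber.gdim_le_ringKrullDim K hG)
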